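/- Let $V$ and $H$ be separable Hilbert spaces over $\mathbb K=\mathbb R$ or $\mathbb C$, with $V$ continuously and densely embedded in $H$, and let $V'$ be the antidual of $V$ (the dual if $\mathbb K=\mathbb R$), with duality $\langle\cdot,\cdot\rangle$; $H$ is embedded in $V'$ by $\langle h,v\rangle=(h\mid v)_H$. Let $T>0$ and let $\mathfrak a:[0,T]\times V\times V\to\mathbb K$ be such that each $\mathfrak a(t,\cdot,\cdot)$ is sesquilinear, $t\mapsto\mathfrak a(t,u,v)$ is measurable for all $u,v\in V$, and there are constants $M,\omega\in\mathbb R$ and $\alpha>0$ with $$|\mathfrak a(t,u,v)|\le M\|u\|_V\|v\|_V,\qquad \operatorname{Re}\mathfrak a(t,u,u)+\omega\|u\|_H^2\ge\alpha\|u\|_V^2\qquad(t\in[0,T],\ u,v\in V).$$ Let $f\in L^2(0,T;V')$. For $u_0\in H$ consider the Cauchy problem $$(CP_f)\qquad \dot u(t)+\mathcal A(t)u(t)=f(t)\ \text{ for a.e. } t\in(0,T),\qquad u(0)=u_0,$$ where $\mathcal A(t):V\to V'$ is given by $\langle\mathcal A(t)u,v\rangle=\mathfrak a(t,u,v)$.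 Its solution is sought in $MR(V,V')=H^1(0,T;V')\cap L^2(0,T;V)$ and is identified with its continuous representative in $C([0,T];H)$. A convex set $\mathcal C\subset H$ is called invariant for $(CP_f)$ if for each $u_0\in\mathcal C$ the solution $u$ of $(CP_f)$ satisfies $u(t)\in\mathcal C$ for all $t\in[0,T]$. Let $\mathcal C_1,\mathcal C_2\subset H$ be closed and convex, with $\mathcal C_2$ nonempty, and let $P_2:H\to\mathcal C_2$ be the orthogonal projection onto $\mathcal C_2$. Suppose that $\mathcal C_1$ is invariant for $(CP_f)$ and that for every $v\in V\cap\mathcal C_1$ one has $P_2v\in V$ and $$\operatorname{Re}\mathfrak a(t,P_2v,v-P_2v)\ge\operatorname{Re}\langle f(t),v-P_2v\rangle\qquad\text{for a.e. } t\in[0,T].$$ Then $\mathcal C_1\cap\mathcal C_2$ is invariant for $(CP_f)$. -/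

import Mathlib

open MeasureTheory Set
open scoped ContDiff

namespace NonautForm

/-- The antidual `V'` of `V`: bounded conjugate-linear functionals, so that `⟨f, v⟩ = f v` is linear
in `f` and antilinear in `v`. For `𝕜 = ℝ` this is the dual space. -/
abbrev Antidual (𝕜 V : Type*) [RCLike 𝕜] [NormedAddCommGroup V] [InnerProductSpace 𝕜 V] :=
  V →L⋆[𝕜] 𝕜

/-- The embedding `H → V'` induced by an embedding `j : V → H`: `h` acts by `v ↦ (h | j v)_H`.
(Mathlib's inner product is linear in its second argument.) -/
noncomputable def toAntidual {𝕜 V H : Type*} [RCLike 𝕜]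
    [NormedAddCommGroup V] [InnerProductSpace 𝕜 V]
    [NormedAddCommGroup H] [InnerProductSpace 𝕜 H]
    (j : V →L[𝕜] H) (h : H) : Antidual 𝕜 V :=
  ((innerSL 𝕜).flip h).comp j

theorem toAntidual_apply {𝕜 V H : Type*} [RCLike 𝕜]
    [NormedAddCommGroup V] [InnerProductSpace 𝕜 V]
    [NormedAddCommGroup H] [InnerProductSpace 𝕜 H]
    (j : V →L[𝕜] H) (h : H) (v : V) : toAntidual j h v = inner 𝕜 (j v) h := rfl

/-- `𝔞 : [0,T] × V × V → 𝕜` is a non-autonomous closed form: each `𝔞(t,·,·)` is sesquilinear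
(linear in the first, antilinear in the second variable), and the family is uniformly `V`-bounded,
uniformly quasi-coercive, and Lebesgue measurable in `t`. Values for `t ∉ [0,T]` play no role. -/
structure IsNonautonomousClosedForm {𝕜 V H : Type*} [RCLike 𝕜]
    [NormedAddCommGroup V] [InnerProductSpace 𝕜 V]
    [NormedAddCommGroup H] [InnerProductSpace 𝕜 H]
    (j : V →L[𝕜] H) (T : ℝ) (a : ℝ → V →ₗ[𝕜] V →ₗ⋆[𝕜] 𝕜) : Prop where
  bounded : ∃ M : ℝ, ∀ t ∈ Icc 0 T, ∀ u v : V, ‖a t u v‖ ≤ M * ‖u‖ * ‖v‖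
  quasiCoercive : ∃ b α : ℝ, 0 < α ∧ ∀ t ∈ Icc 0 T, ∀ u : V,
    α * ‖u‖ ^ 2 ≤ RCLike.re (a t u u) + b * ‖j u‖ ^ 2
  measurable : ∀ u v : V,
    AEStronglyMeasurable (fun t : ℝ => a t u v) (volume.restrict (Icc 0 T))

/-- `g ∈ L²(0,T;E)` (for a function representing its class). -/
def MemL2 {E : Type*} [NormedAddCommGroup E] (T : ℝ) (g : ℝ → E) : Prop :=
  MemLp g 2 (volume.restrict (Ioo 0 T))

/-- `dg` is the weak derivative of `g` on `(0,T)`: `-∫ φ' g = ∫ φ dg` for all scalar test functions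
`φ ∈ C_c^∞(0,T)`. Used for `g` and `dg` in `L²(0,T;E)` only. -/
def HasWeakDeriv {E : Type*} [NormedAddCommGroup E] [NormedSpace ℝ E] (T : ℝ)
    (g dg : ℝ → E) : Prop :=
  ∀ φ : ℝ → ℝ, ContDiff ℝ ∞ φ → HasCompactSupport φ → tsupport φ ⊆ Ioo 0 T →
    -∫ t in Ioo 0 T, deriv φ t • g t = ∫ t in Ioo 0 T, φ t • dg t

/-- `u ∈ MR(V,V') = H¹(0,T;V') ∩ L²(0,T;V)`, with weak derivative `du ∈ L²(0,T;V')`. -/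
structure MemMR {𝕜 V H : Type*} [RCLike 𝕜]
    [NormedAddCommGroup V] [InnerProductSpace 𝕜 V]
    [NormedAddCommGroup H] [InnerProductSpace 𝕜 H]
    (j : V →L[𝕜] H) (T : ℝ) (u : ℝ → V) (du : ℝ → Antidual 𝕜 V) : Prop where
  memL2 : MemL2 T u
  memL2_deriv : MemL2 T du
  weakDeriv : HasWeakDeriv T (fun t => toAntidual j (j (u t))) du

/-- `u` is a solution of the Cauchy problem `u' + 𝒜(t) u = f`, `u(0) = u₀`, where
`⟨𝒜(t) x, v⟩ = 𝔞(t, x, v)`, and `w : [0,T] → H` is the continuous representative of `u` in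
`C([0,T];H)` (values of `w` off `[0,T]` play no role). -/
structure IsSolution {𝕜 V H : Type*} [RCLike 𝕜]
    [NormedAddCommGroup V] [InnerProductSpace 𝕜 V]
    [NormedAddCommGroup H] [InnerProductSpace 𝕜 H]
    (j : V →L[𝕜] H) (T : ℝ) (a : ℝ → V →ₗ[𝕜] V →ₗ⋆[𝕜] 𝕜) (f : ℝ → Antidual 𝕜 V)
    (u₀ : H) (u : ℝ → V) (w : ℝ → H) : Prop where
  equation : ∃ du : ℝ → Antidual 𝕜 V, MemMR j T u du ∧
    ∀ᵐ t ∂(volume.restrict (Ioo 0 T)), ∀ v : V, du t v + a t (u t) v = f t v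
  continuousOn : ContinuousOn w (Icc 0 T)
  representative : ∀ᵐ t ∂(volume.restrict (Ioo 0 T)), w t = j (u t)
  initial : w 0 = u₀

/-- `C` is invariant for the Cauchy problem with right-hand side `f`: for each `u₀ ∈ C` the
solution (its continuous representative) stays in `C` on all of `[0,T]`. -/
def IsInvariant {𝕜 V H : Type*} [RCLike 𝕜]
    [NormedAddCommGroup V] [InnerProductSpace 𝕜 V]
    [NormedAddCommGroup H] [InnerProductSpace 𝕜 H]
    (j : V →L[𝕜] H) (T : ℝ) (a : ℝ → V →ₗ[𝕜] V →ₗ⋆[𝕜] 𝕜) (f : ℝ → Antidual 𝕜 V)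
    (C : Set H) : Prop :=
  ∀ u₀ ∈ C, ∀ (u : ℝ → V) (w : ℝ → H), IsSolution j T a f u₀ u w → ∀ t ∈ Icc 0 T, w t ∈ C

/-- Existence and uniqueness of the orthogonal projection onto a nonempty closed convex set. -/
theorem existsUnique_proj (𝕜 : Type*) {H : Type*} [RCLike 𝕜] [NormedAddCommGroup H]
    [InnerProductSpace 𝕜 H] [CompleteSpace H] [NormedSpace ℝ H] [IsScalarTower ℝ 𝕜 H]
    {C : Set H} (hne : C.Nonempty) (hcl : IsClosed C) (hconv : Convex ℝ C) (x : H) :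
    ∃! p : H, p ∈ C ∧ ∀ y ∈ C, RCLike.re (inner 𝕜 (x - p) (y - p)) ≤ 0 := by
  have hex : ∃ p : H, p ∈ C ∧ ∀ y ∈ C, RCLike.re (inner 𝕜 (x - p) (y - p)) ≤ 0 := by
    have hc : ∀ y ∈ C, ∀ z ∈ C, ∀ s t : ℝ, 0 ≤ s → 0 ≤ t → s + t = 1 →
        (s : 𝕜) • y + (t : 𝕜) • z ∈ C := by
      intro y hy z hz s t hs ht hst
      have h := hconv hy hz hs ht hst
      rwa [← algebraMap_smul 𝕜 s y, ← algebraMap_smul 𝕜 t z] at h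
    let ins : InnerProductSpace ℝ H := InnerProductSpace.rclikeToReal 𝕜 H
    have hconv' : @Convex ℝ H _ _ _ ins.toModule.toSMul C :=
      fun y hy z hz s t hs ht hst => hc y hy z hz s t hs ht hst
    obtain ⟨p, hp, hmin⟩ := @exists_norm_eq_iInf_of_complete_convex H _ ins C hne
      hcl.isComplete hconv' x
    exact ⟨p, hp, (@norm_eq_iInf_iff_real_inner_le_zero H _ ins C hconv' x p hp).1 hmin⟩
  obtain ⟨p, hp, hpv⟩ := hex
  refine ⟨p, ⟨hp, hpv⟩, ?_⟩
  rintro q ⟨hq, hqv⟩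
  have h1 := hpv q hq
  have h2 := hqv p hp
  have h3 : RCLike.re (inner 𝕜 (q - p) (q - p) : 𝕜) ≤ 0 := by
    have e : (inner 𝕜 (q - p) (q - p) : 𝕜)
        = inner 𝕜 (x - p) (q - p) + inner 𝕜 (x - q) (p - q) := by
      rw [← neg_sub q p, inner_neg_right, ← sub_eq_add_neg, ← inner_sub_left]
      congr 1
      abel
    rw [e, map_add]
    linarith
  have h4 : ‖q - p‖ ^ 2 ≤ 0 := by
    rwa [← inner_self_eq_norm_sq (𝕜 := 𝕜)]
  have h5 : ‖q - p‖ = 0 := by nlinarith [norm_nonneg (q - p)]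
  exact sub_eq_zero.1 (norm_eq_zero.1 h5)

/-- The orthogonal projection `P : H → C` onto a nonempty closed convex set: `P x` is the unique
`p ∈ C` with `Re (x - p | y - p)_H ≤ 0` for all `y ∈ C`. -/
noncomputable def proj (𝕜 : Type*) {H : Type*} [RCLike 𝕜] [NormedAddCommGroup H]
    [InnerProductSpace 𝕜 H] [CompleteSpace H] [NormedSpace ℝ H] [IsScalarTower ℝ 𝕜 H]
    {C : Set H} (hne : C.Nonempty) (hcl : IsClosed C) (hconv : Convex ℝ C) (x : H) : H :=
  (existsUnique_proj 𝕜 hne hcl hconv x).choose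

theorem proj_spec (𝕜 : Type*) {H : Type*} [RCLike 𝕜] [NormedAddCommGroup H]
    [InnerProductSpace 𝕜 H] [CompleteSpace H] [NormedSpace ℝ H] [IsScalarTower ℝ 𝕜 H]
    {C : Set H} (hne : C.Nonempty) (hcl : IsClosed C) (hconv : Convex ℝ C) (x : H) :
    proj 𝕜 hne hcl hconv x ∈ C ∧ ∀ y ∈ C,
      RCLike.re (inner 𝕜 (x - proj 𝕜 hne hcl hconv x) (y - proj 𝕜 hne hcl hconv x)) ≤ 0 :=
  (existsUnique_proj 𝕜 hne hcl hconv x).choose_spec.1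

end NonautForm

/-!
Let `P` be the projection onto `C₂` and `ψ(t) = ‖w(t) - P w(t)‖_H²` the squared distance of the
solution to `C₂`. Formally, with `g = u - P u`,

  `ψ' = 2 Re ⟨u', g⟩ = 2 (Re ⟨f, g⟩ - Re 𝔞(t, P u, g) - Re 𝔞(t, g, g)) ≤ 2 b ψ`,

by the hypothesis on `P` and quasi-coercivity. As `ψ(0) = 0`, Grönwall's inequality gives `ψ = 0`.

Two points need care.

* The hypothesis holds for each `v` outside a null set of times depending on `v`, and is needed at
  `v = u(t)`. Coercivity turns the inequality at a single time into a bound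
  `‖P v‖_V ≤ K (1 + ‖v‖_V)` (`exists_norm_le_of_re_form_ge`). Hence `P` maps `V`-convergent sequences
  to sequences converging weakly in `V` (`tendsto_apply_of_bounded_of_tendsto`), and by weak lower
  semicontinuity the inequality passes from a countable `V`-dense set to all `v` at once
  (`re_form_ge_of_mem_closure`, `ae_forall_re_form_ge`).

* The chain rule for `ψ` is replaced by a one-sided estimate. The squared distance is convex with
  gradient `2 (x - P x)` (`norm_sub_proj_sq_sub_le`), so
  `ψ(t) - ψ(t - h) ≤ 2 Re ⟨w(t) - w(t - h), g(t)⟩`. Here `w(t) - w(t - h)` is the integral of `u'` in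
  `V'` (`HasWeakDeriv.integral_eq_sub`), which differs from `h u'(t)` by an error that is `o(h)` after
  integration in `t`, by continuity of translations in `L²`
  (`exists_forall_lintegral_enorm_mul_le`). Integrating in `t` and letting `h → 0` gives
  `ψ(r) ≤ 2 |b| ∫₀ʳ ψ` (`exists_integral_increment_le`, `nonpos_of_integral_increment_le`).
-/

namespace NonautForm
open Filter Topology

/-! ### The projection onto a closed convex set -/

section Projection

variable {𝕜 H : Type*} [RCLike 𝕜] [NormedAddCommGroup H] [InnerProductSpace 𝕜 H]

/-- Convexity of half the squared distance `x ↦ ‖x - P x‖² / 2`, whose gradient at `x` is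
`x - P x`: the graph lies above its tangents. -/
theorem norm_sub_proj_sq_sub_le {C : Set H} {x y p q : H}
    (hp : ∀ z ∈ C, RCLike.re (inner 𝕜 (x - p) (z - p)) ≤ 0) (hq : q ∈ C) :
    ‖x - p‖ ^ 2 - ‖y - q‖ ^ 2 ≤ 2 * RCLike.re (inner 𝕜 (x - p) (x - y)) := by
  have h1 := hp q hq
  have h2 : ‖y - q‖ ^ 2 = ‖x - p‖ ^ 2 + 2 * RCLike.re (inner 𝕜 (x - p) ((y - q) - (x - p)))
      + ‖(y - q) - (x - p)‖ ^ 2 := by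
    rw [← norm_add_sq (𝕜 := 𝕜)]
    congr 2
    abel
  have h3 : (y - q) - (x - p) = -(x - y) - (q - p) := by abel
  rw [h3, inner_sub_right, inner_neg_right, map_sub, map_neg] at h2
  nlinarith [sq_nonneg ‖-(x - y) - (q - p)‖]

theorem norm_proj_sub_proj_le {C : Set H} {x y p q : H} (hpC : p ∈ C) (hqC : q ∈ C)
    (hp : ∀ z ∈ C, RCLike.re (inner 𝕜 (x - p) (z - p)) ≤ 0)
    (hq : ∀ z ∈ C, RCLike.re (inner 𝕜 (y - q) (z - q)) ≤ 0) :
    ‖p - q‖ ≤ ‖x - y‖ := by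
  have h1 := hp q hqC
  have h2 := hq p hpC
  have h3 : RCLike.re (inner 𝕜 (x - y) (p - q)) = ‖p - q‖ ^ 2
      - RCLike.re (inner 𝕜 (x - p) (q - p)) - RCLike.re (inner 𝕜 (y - q) (p - q)) := by
    rw [← inner_self_eq_norm_sq (𝕜 := 𝕜), ← map_sub, ← map_sub, ← neg_sub p q, inner_neg_right,
      sub_neg_eq_add, ← inner_add_left, ← inner_sub_left]
    congr 2
    abel
  have h4 : RCLike.re (inner 𝕜 (x - y) (p - q)) ≤ ‖x - y‖ * ‖p - q‖ :=
    re_inner_le_norm _ _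
  by_contra! h
  nlinarith [norm_nonneg (x - y), norm_nonneg (p - q)]

end Projection

/-! ### Forms on a densely embedded space -/

section Forms

variable {𝕜 V H : Type*} [RCLike 𝕜]
    [NormedAddCommGroup V] [InnerProductSpace 𝕜 V]
    [NormedAddCommGroup H] [InnerProductSpace 𝕜 H]

/-- A `V`-bounded sequence that converges in `H` to an element of `V` converges weakly in `V`:
as `j` is injective, the functionals `(j · | h)_H` are dense in the dual of `V`. -/
theorem tendsto_apply_of_bounded_of_tendsto [CompleteSpace V] [CompleteSpace H]
    {j : V →L[𝕜] H} (hj : Function.Injective j)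
    {x : ℕ → V} {x₀ : V} {B : ℝ} (hB : ∀ n, ‖x n‖ ≤ B)
    (hx : Tendsto (fun n => j (x n)) atTop (𝓝 (j x₀))) (L : V →L[𝕜] 𝕜) :
    Tendsto (fun n => L (x n)) atTop (𝓝 (L x₀)) := by
  have hdense : Dense (Set.range (ContinuousLinearMap.adjoint j)) := by
    have h : (ContinuousLinearMap.adjoint j).rangeᗮ = ⊥ := by
      rw [ContinuousLinearMap.orthogonal_range, ContinuousLinearMap.adjoint_adjoint]
      exact LinearMap.ker_eq_bot.2 hj
    rw [← Submodule.topologicalClosure_eq_top_iff] at h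
    have h2 := Submodule.dense_iff_topologicalClosure_eq_top.2 h
    exact h2
  obtain ⟨y, rfl⟩ := (InnerProductSpace.toDual 𝕜 V).surjective L
  simp only [InnerProductSpace.toDual_apply_apply]
  rw [Metric.tendsto_atTop]
  intro ε hε
  have hB0 : 0 ≤ B := (norm_nonneg _).trans (hB 0)
  have hK : 0 < B + ‖x₀‖ + 1 := by positivity
  obtain ⟨_, ⟨h, rfl⟩, hh⟩ := hdense.exists_dist_lt y
    (show 0 < ε / 2 / (B + ‖x₀‖ + 1) by positivity)
  have h1 : Tendsto (fun n => (inner 𝕜 h (j (x n)) : 𝕜)) atTop (𝓝 (inner 𝕜 h (j x₀))) :=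
    Filter.Tendsto.inner tendsto_const_nhds hx
  obtain ⟨N, hN⟩ := Metric.tendsto_atTop.1 h1 (ε / 2) (by positivity)
  refine ⟨N, fun n hn => ?_⟩
  have h2 := hN n hn
  rw [dist_eq_norm] at h2 hh ⊢
  have h3 : (inner 𝕜 y (x n) : 𝕜) - inner 𝕜 y x₀
      = inner 𝕜 (y - ContinuousLinearMap.adjoint j h) (x n - x₀)
        + (inner 𝕜 h (j (x n)) - inner 𝕜 h (j x₀)) := by
    rw [inner_sub_left, ContinuousLinearMap.adjoint_inner_left, map_sub, inner_sub_right,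
      inner_sub_right]
    ring
  have h4 : ‖x n - x₀‖ ≤ B + ‖x₀‖ + 1 := by
    linarith [norm_sub_le (x n) x₀, hB n]
  have h5 : ‖(inner 𝕜 (y - ContinuousLinearMap.adjoint j h) (x n - x₀) : 𝕜)‖
      ≤ ε / 2 := by
    refine (norm_inner_le_norm _ _).trans ?_
    calc _ ≤ ε / 2 / (B + ‖x₀‖ + 1) * (B + ‖x₀‖ + 1) := by gcongr
      _ = ε / 2 := by field_simp
  rw [h3]
  exact (norm_add_le _ _).trans_lt (by linarith)

/-- The inequality `Re a(p, v - p) ≥ Re ⟨F, v - p⟩` together with coercivity controls `‖p‖_V` by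
`‖v‖_V` as soon as `‖p‖_H` is controlled. -/
theorem exists_norm_le_of_re_form_ge (j : V →L[𝕜] H) {a : V →ₗ[𝕜] V →ₗ⋆[𝕜] 𝕜}
    (F : Antidual 𝕜 V) {M b α : ℝ} (hM : ∀ u v, ‖a u v‖ ≤ M * ‖u‖ * ‖v‖) (hα : 0 < α)
    (hco : ∀ u, α * ‖u‖ ^ 2 ≤ RCLike.re (a u u) + b * ‖j u‖ ^ 2) (c : ℝ) (hc : 0 ≤ c) :
    ∃ K : ℝ, 0 ≤ K ∧ ∀ v p : V, ‖j p‖ ≤ ‖j v‖ + c →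
      RCLike.re (F (v - p)) ≤ RCLike.re (a p (v - p)) → ‖p‖ ≤ K * (1 + ‖v‖) := by
  set A : ℝ := |M| + 2 * ‖F‖ + |b| * (‖j‖ + c) ^ 2 with hA
  have hA0 : 0 ≤ A := by positivity
  refine ⟨max 1 (A / α), by positivity, fun v p hp h => ?_⟩
  set z : ℝ := 1 + ‖v‖ with hz
  have hz1 : 1 ≤ z := by linarith [norm_nonneg v]
  rcases le_total ‖p‖ z with hpz | hpz
  · calc ‖p‖ ≤ 1 * z := by linarith
      _ ≤ _ := by gcongr; exact le_max_left _ _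
  have hjp : ‖j p‖ ≤ (‖j‖ + c) * z := by
    have := j.le_opNorm v
    nlinarith [norm_nonneg j, norm_nonneg v]
  have h1 : RCLike.re (a p p) ≤ ‖a p v‖ + ‖F (v - p)‖ := by
    have h2 := RCLike.re_le_norm (a p v)
    have h3 := (abs_le.1 (RCLike.abs_re_le_norm (F (v - p)))).1
    simp only [map_sub] at h h3 ⊢
    linarith
  have h2 : ‖a p v‖ ≤ |M| * z * ‖p‖ := by
    refine (hM p v).trans ?_
    calc M * ‖p‖ * ‖v‖ ≤ |M| * ‖p‖ * z := by
          gcongr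
          · exact le_abs_self M
          · linarith
      _ = _ := by ring
  have h3 : ‖F (v - p)‖ ≤ 2 * ‖F‖ * z * ‖p‖ := by
    refine (F.le_opNorm _).trans ?_
    have h4 : ‖v - p‖ ≤ 2 * z * ‖p‖ := by
      have := norm_sub_le v p
      nlinarith [norm_nonneg p]
    nlinarith [norm_nonneg F]
  have h4 : b * ‖j p‖ ^ 2 ≤ |b| * (‖j‖ + c) ^ 2 * z * ‖p‖ := by
    calc b * ‖j p‖ ^ 2 ≤ |b| * ((‖j‖ + c) * z) ^ 2 := by
          gcongr
          exact le_abs_self b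
      _ = |b| * (‖j‖ + c) ^ 2 * z * z := by ring
      _ ≤ _ := by gcongr
  have h5 : α * ‖p‖ ^ 2 ≤ A * z * ‖p‖ := by
    have := hco p
    rw [hA]
    nlinarith
  have h6 : ‖p‖ ≤ A / α * z := by
    have hp0 : 0 < ‖p‖ := by linarith
    rw [div_mul_eq_mul_div, le_div_iff₀ hα]
    nlinarith
  refine h6.trans ?_
  gcongr
  exact le_max_right _ _

/-- For a fixed form, the inequality `Re a(p v, v - p v) ≥ Re ⟨F, v - p v⟩` extends from a subset to
its `V`-closure. The map `p` need not be `V`-continuous; it is `V`-bounded and `H`-continuous, hence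
sequentially continuous into `V` with its weak topology, and `u ↦ Re a(u, u) + b ‖u‖_H²` is convex,
hence weakly lower semicontinuous. -/
theorem re_form_ge_of_mem_closure [CompleteSpace V] [CompleteSpace H]
    {j : V →L[𝕜] H} (hj : Function.Injective j) {a : V →ₗ[𝕜] V →ₗ⋆[𝕜] 𝕜}
    (F : Antidual 𝕜 V) {M b α : ℝ} (hM : ∀ u v, ‖a u v‖ ≤ M * ‖u‖ * ‖v‖) (hα : 0 < α)
    (hco : ∀ u, α * ‖u‖ ^ 2 ≤ RCLike.re (a u u) + b * ‖j u‖ ^ 2) {c : ℝ} (hc : 0 ≤ c)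
    {S D : Set V} (hD : D ⊆ S) (p : V → V) (hpc : ∀ v ∈ S, ‖j (p v)‖ ≤ ‖j v‖ + c)
    (hp : ∀ v ∈ S, ∀ w ∈ S, ‖j (p v) - j (p w)‖ ≤ ‖j v - j w‖)
    (h : ∀ v ∈ D, RCLike.re (F (v - p v)) ≤ RCLike.re (a (p v) (v - p v)))
    {v : V} (hvS : v ∈ S) (hv : v ∈ closure D) :
    RCLike.re (F (v - p v)) ≤ RCLike.re (a (p v) (v - p v)) := by
  obtain ⟨K, hK, hbound⟩ := exists_norm_le_of_re_form_ge j F hM hα hco c hc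
  obtain ⟨x, hxD, hx⟩ := mem_closure_iff_seq_limit.1 hv
  obtain ⟨R, hR⟩ : ∃ R, ∀ n, ‖x n‖ ≤ R := by
    obtain ⟨R, hR⟩ := hx.norm.bddAbove_range
    exact ⟨R, fun n => hR ⟨n, rfl⟩⟩
  have hB : ∀ n, ‖p (x n)‖ ≤ K * (1 + R) := fun n =>
    (hbound _ _ (hpc _ (hD (hxD n))) (h _ (hxD n))).trans (by gcongr; exact hR n)
  have hjx : Tendsto (fun n => j (x n)) atTop (𝓝 (j v)) := (j.continuous.tendsto v).comp hx
  have hjp : Tendsto (fun n => j (p (x n))) atTop (𝓝 (j (p v))) := by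
    rw [tendsto_iff_norm_sub_tendsto_zero] at hjx ⊢
    exact squeeze_zero (fun _ => norm_nonneg _) (fun n => hp _ (hD (hxD n)) _ hvS) hjx
  have hweak := tendsto_apply_of_bounded_of_tendsto hj hB hjp
  -- the functionals `a(·, u)`, `conj a(u, ·)` and `conj ⟨F, ·⟩` are linear and bounded
  have hl : ∀ u, Tendsto (fun n => RCLike.re (a (p (x n)) u)) atTop (𝓝 (RCLike.re (a (p v) u))) := by
    intro u
    let L : V →L[𝕜] 𝕜 := LinearMap.mkContinuous
      { toFun := fun z => a z u
        map_add' := fun z w => by simp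
        map_smul' := fun r z => by simp } (M * ‖u‖)
      (fun z => (hM z u).trans_eq (by ring))
    exact (RCLike.continuous_re.tendsto _).comp (hweak L)
  have hr : ∀ u, Tendsto (fun n => RCLike.re (a u (p (x n)))) atTop (𝓝 (RCLike.re (a u (p v)))) := by
    intro u
    let L : V →L[𝕜] 𝕜 := LinearMap.mkContinuous
      { toFun := fun z => (starRingEnd 𝕜) (a u z)
        map_add' := fun z w => by simp
        map_smul' := fun r z => by simp } (M * ‖u‖)
      (fun z => by simpa using hM u z)
    have := (RCLike.continuous_re.tendsto _).comp (hweak L)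
    simpa [L, Function.comp_def] using this
  have hF : Tendsto (fun n => RCLike.re (F (p (x n)))) atTop (𝓝 (RCLike.re (F (p v)))) := by
    let L : V →L[𝕜] 𝕜 := LinearMap.mkContinuous
      { toFun := fun z => (starRingEnd 𝕜) (F z)
        map_add' := fun z w => by simp
        map_smul' := fun r z => by simp } ‖F‖
      (fun z => by simpa using F.le_opNorm z)
    have := (RCLike.continuous_re.tendsto _).comp (hweak L)
    simpa [L, Function.comp_def] using this
  have hFx : Tendsto (fun n => RCLike.re (F (x n))) atTop (𝓝 (RCLike.re (F v))) :=
    (RCLike.continuous_re.tendsto _).comp ((F.continuous.tendsto v).comp hx)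
  have hax : Tendsto (fun n => RCLike.re (a (p (x n)) (x n - v))) atTop (𝓝 0) := by
    refine squeeze_zero_norm (a := fun n => |M| * (K * (1 + R)) * ‖x n - v‖) (fun n => ?_) ?_
    · rw [Real.norm_eq_abs]
      refine (RCLike.abs_re_le_norm _).trans ((hM _ _).trans ?_)
      gcongr
      · exact le_abs_self M
      · exact hB n
    · simpa using (tendsto_iff_norm_sub_tendsto_zero.1 hx).const_mul (|M| * (K * (1 + R)))
  -- convexity of `u ↦ Re a(u, u) + b ‖u‖_H²` bounds `-Re a(p xₙ, p xₙ)` from above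
  have hupper : ∀ n, RCLike.re (F (x n)) - RCLike.re (F (p (x n))) ≤
      RCLike.re (a (p (x n)) (x n - v)) + RCLike.re (a (p (x n)) v)
      + b * ‖j (p (x n)) - j (p v)‖ ^ 2 - RCLike.re (a (p (x n)) (p v))
      - RCLike.re (a (p v) (p (x n))) + RCLike.re (a (p v) (p v)) := by
    intro n
    have h1 := h _ (hxD n)
    have h2 := hco (p (x n) - p v)
    have h3 : 0 ≤ α * ‖p (x n) - p v‖ ^ 2 := by positivity
    simp only [map_sub, LinearMap.sub_apply] at h1 h2 ⊢
    linarith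
  have hlim := le_of_tendsto_of_tendsto' (hFx.sub hF)
    (((((hax.add (hl v)).add ((((tendsto_iff_norm_sub_tendsto_zero.1 hjp).pow 2).const_mul b))).sub
      (hl (p v))).sub (hr (p v))).add tendsto_const_nhds) hupper
  simp only [map_sub]
  simp only [ne_eq, OfNat.ofNat_ne_zero, not_false_eq_true, zero_pow, mul_zero] at hlim
  linarith

end Forms

/-! ### Averaged translates in `L²` -/

section Translation

open scoped ENNReal

variable {E : Type*} [NormedAddCommGroup E]

theorem tendsto_eLpNorm_translate_sub {D : ℝ → E} (hD : MemLp D 2 volume) :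
    Tendsto (fun r : ℝ => eLpNorm (fun t => D (t - r) - D t) 2 volume) (𝓝 0) (𝓝 0) := by
  have hmp : ∀ r : ℝ, MeasurePreserving (fun t : ℝ => t - r) volume volume :=
    fun r => measurePreserving_sub_right volume r
  let g : C(ℝ, C(ℝ, ℝ)) :=
    (ContinuousMap.mk (fun q : ℝ × ℝ => q.2 - q.1) (by fun_prop)).curry
  have h := (continuous_const (y := hD.toLp D)).compMeasurePreservingLp (Z := ℝ) (p := 2)
    (E := E) (μ := volume) (ν := volume) g.continuous hmp (by simp)
  have h0 := h.tendsto 0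
  have h1 := (EMetric.tendsto_nhds.1 h0)
  rw [ENNReal.tendsto_nhds_zero]
  intro ε hε
  filter_upwards [h1 ε hε] with r hr
  rw [Lp.edist_def] at hr
  refine le_of_eq_of_le (eLpNorm_congr_ae ?_) hr.le
  have e : ∀ r : ℝ, Lp.compMeasurePreserving (g r) (hmp r) (hD.toLp D) =ᵐ[volume]
      fun t => D (t - r) := fun r =>
    (Lp.coeFn_compMeasurePreserving _ (hmp r)).trans
      ((hmp r).quasiMeasurePreserving.ae_eq_comp hD.coeFn_toLp)
  filter_upwards [e r, e 0] with t h1 h2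
  simp only [Pi.sub_apply]
  rw [h1, h2, sub_zero]

/-- The average over `s ∈ (t - h, t]` of `‖D s - D t‖`, paired with an `L²` function of `t`, tends
to zero with `h`. -/
theorem exists_forall_lintegral_enorm_mul_le {m : ℝ → ℝ} (hm : MemLp m 2 volume)
    {D : ℝ → E} (hD : MemLp D 2 volume) {ε : ℝ} (hε : 0 < ε) :
    ∃ δ > 0, ∀ h, 0 < h → h < δ →
      ∫⁻ t, ‖m t‖ₑ * ∫⁻ s in Ioc (t - h) t, ‖D s - D t‖ₑ ≤ ENNReal.ofReal (ε * h) := by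
  set N : ℝ := (eLpNorm m 2 volume).toReal with hN
  have hNm : eLpNorm m 2 volume = ENNReal.ofReal N := (ENNReal.ofReal_toReal hm.2.ne).symm
  have hN0 : 0 ≤ N := ENNReal.toReal_nonneg
  have h1 := ENNReal.tendsto_nhds_zero.1 (tendsto_eLpNorm_translate_sub hD)
    (ENNReal.ofReal (ε / (N + 1))) (by simp; positivity)
  obtain ⟨δ, hδ, hball⟩ := Metric.eventually_nhds_iff.1 h1
  refine ⟨δ, hδ, fun h hh hhδ => ?_⟩
  have hshift : ∀ t, ∫⁻ s in Ioc (t - h) t, ‖D s - D t‖ₑ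
      = ∫⁻ r in Ico 0 h, ‖D (t - r) - D t‖ₑ := by
    intro t
    rw [← lintegral_indicator measurableSet_Ioc, ← lintegral_indicator measurableSet_Ico,
      ← lintegral_sub_left_eq_self _ t]
    refine lintegral_congr fun r => ?_
    have : t - r ∈ Ioc (t - h) t ↔ r ∈ Ico 0 h := by
      simp only [mem_Ioc, mem_Ico]
      constructor <;> rintro ⟨h1, h2⟩ <;> constructor <;> linarith
    by_cases hr : r ∈ Ico 0 h
    · rw [indicator_of_mem hr, indicator_of_mem (this.2 hr)]
    · rw [indicator_of_notMem hr, indicator_of_notMem (fun h => hr (this.1 h))]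
  have hmeas : AEStronglyMeasurable (fun q : ℝ × ℝ => D (q.1 - q.2) - D q.1)
      (volume.prod (volume.restrict (Ico 0 h))) := by
    have h1 : AEStronglyMeasurable (fun q : ℝ × ℝ => D (q.1 - q.2) - D q.1)
        (volume.prod volume) :=
      (hD.1.comp_quasiMeasurePreserving (quasiMeasurePreserving_sub volume volume)).sub
        hD.1.comp_fst
    refine h1.mono_ac (Measure.AbsolutelyContinuous.prod .rfl ?_)
    exact Measure.absolutelyContinuous_of_le Measure.restrict_le_self
  calc ∫⁻ t, ‖m t‖ₑ * ∫⁻ s in Ioc (t - h) t, ‖D s - D t‖ₑ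
      = ∫⁻ t, ∫⁻ r in Ico 0 h, ‖m t‖ₑ * ‖D (t - r) - D t‖ₑ := by
        refine lintegral_congr fun t => ?_
        rw [hshift, lintegral_const_mul' _ _ enorm_ne_top]
    _ = ∫⁻ r in Ico 0 h, ∫⁻ t, ‖m t‖ₑ * ‖D (t - r) - D t‖ₑ :=
        lintegral_lintegral_swap (hm.1.comp_fst.enorm.mul hmeas.enorm)
    _ ≤ ∫⁻ r in Ico 0 h, ENNReal.ofReal ε := by
        refine setLIntegral_mono measurable_const fun r hr => ?_
        have hr' : eLpNorm (fun t => D (t - r) - D t) 2 volume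
            ≤ ENNReal.ofReal (ε / (N + 1)) := by
          refine hball ?_
          rw [Real.dist_eq, sub_zero, abs_of_nonneg hr.1]
          exact hr.2.trans hhδ
        have hmr : AEStronglyMeasurable (fun t => D (t - r) - D t) volume :=
          (hD.1.comp_measurePreserving (measurePreserving_sub_right volume r)).sub hD.1
        have hol := eLpNorm_smul_le_mul_eLpNorm (p := 2) (q := 2) (r := 1) hmr.norm hm.1
        rw [eLpNorm_norm, eLpNorm_one_eq_lintegral_enorm] at hol
        calc ∫⁻ t, ‖m t‖ₑ * ‖D (t - r) - D t‖ₑ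
            ≤ eLpNorm m 2 volume * eLpNorm (fun t => D (t - r) - D t) 2 volume := by
              simpa [enorm_smul] using hol
          _ ≤ ENNReal.ofReal N * ENNReal.ofReal (ε / (N + 1)) := by
              rw [hNm]
              gcongr
          _ ≤ ENNReal.ofReal ε := by
              rw [← ENNReal.ofReal_mul hN0]
              refine ENNReal.ofReal_le_ofReal ?_
              rw [← mul_div_assoc, div_le_iff₀ (by positivity)]
              nlinarith
    _ = ENNReal.ofReal (ε * h) := by
        rw [setLIntegral_const, Real.volume_Ico, sub_zero, ENNReal.ofReal_mul hε.le]

end Translation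

/-! ### A Grönwall argument -/

/-- A nonnegative continuous function with `ψ b ≤ c ∫₀ᵇ ψ` vanishes. -/
theorem nonpos_of_le_mul_integral {ψ : ℝ → ℝ} (hψ : Continuous ψ) (hψ0 : ∀ t, 0 ≤ ψ t) {T c : ℝ}
    (h : ∀ b ∈ Icc 0 T, ψ b ≤ c * ∫ t in (0 : ℝ)..b, ψ t) {b : ℝ} (hb : b ∈ Icc 0 T) :
    ψ b ≤ 0 := by
  have hderiv : ∀ x, HasDerivAt (fun x => ∫ t in (0 : ℝ)..x, ψ t) (ψ x) x := fun x =>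
    intervalIntegral.integral_hasDerivAt_right (hψ.intervalIntegrable _ _)
      hψ.stronglyMeasurable.stronglyMeasurableAtFilter hψ.continuousAt
  have hle : ∫ t in (0 : ℝ)..b, ψ t ≤ 0 := by
    have := le_gronwallBound_of_liminf_deriv_right_le (f := fun x => ∫ t in (0 : ℝ)..x, ψ t)
      (f' := ψ) (δ := 0) (K := c) (ε := 0) (a := 0) (b := T)
      (fun x _ => (hderiv x).continuousAt.continuousWithinAt)
      (fun x _ r hr => (hderiv x).hasDerivWithinAt.liminf_right_slope_le hr) (by simp)
      (fun x hx => by simpa using h x ⟨hx.1, hx.2.le⟩) b hb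
    rwa [gronwallBound_ε0_δ0] at this
  have hnn : 0 ≤ ∫ t in (0 : ℝ)..b, ψ t :=
    intervalIntegral.integral_nonneg hb.1 fun t _ => hψ0 t
  have := h b hb
  rwa [le_antisymm hle hnn, mul_zero] at this

/-- Grönwall's inequality for averaged increments: if
`∫ₕᵇ (ψ(t) - ψ(t - h)) dt ≤ h (c ∫₀ᵇ ψ + o(1))` as `h → 0` and `ψ 0 = 0`, then `ψ = 0`. -/
theorem nonpos_of_integral_increment_le {ψ : ℝ → ℝ} (hψ : Continuous ψ) (hψ0 : ∀ t, 0 ≤ ψ t)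
    (hzero : ψ 0 = 0) {T c : ℝ}
    (hincr : ∀ b ∈ Ioc 0 T, ∀ ε > 0, ∃ δ > 0, ∀ h, 0 < h → h < δ → h < b →
      ∫ t in h..b, (ψ t - ψ (t - h)) ≤ h * (c * (∫ t in (0 : ℝ)..b, ψ t) + ε))
    {b : ℝ} (hb : b ∈ Icc 0 T) : ψ b ≤ 0 := by
  refine nonpos_of_le_mul_integral hψ hψ0 (T := T) (c := c) (fun b hb => ?_) hb
  rcases hb.1.eq_or_lt with rfl | hb0
  · simp [hzero]
  refine le_of_forall_pos_le_add fun ε hε => ?_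
  obtain ⟨δ, hδ, hinc⟩ := hincr b ⟨hb0, hb.2⟩ (ε / 3) (by positivity)
  obtain ⟨δ₁, hδ₁, h₁⟩ := Metric.continuous_iff.1 hψ b (ε / 3) (by positivity)
  obtain ⟨δ₂, hδ₂, h₂⟩ := Metric.continuous_iff.1 hψ 0 (ε / 3) (by positivity)
  obtain ⟨h, hh, hlt⟩ := exists_between (show 0 < min (min δ b) (min δ₁ δ₂) by
    positivity)
  simp only [lt_min_iff] at hlt
  obtain ⟨⟨hlδ, hlb⟩, hl₁, hl₂⟩ := hlt
  have hint : ∀ x y, IntervalIntegrable ψ volume x y := fun x y => hψ.intervalIntegrable x y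
  have hsplit : ∫ t in h..b, (ψ t - ψ (t - h))
      = (∫ t in (b - h)..b, ψ t) - ∫ t in (0 : ℝ)..h, ψ t := by
    rw [intervalIntegral.integral_sub (hint _ _)
      (Continuous.intervalIntegrable (by fun_prop) _ _),
      intervalIntegral.integral_comp_sub_right (fun t => ψ t), sub_self]
    have e1 := intervalIntegral.integral_add_adjacent_intervals (hint 0 h) (hint h b)
    have e2 := intervalIntegral.integral_add_adjacent_intervals (hint 0 (b - h)) (hint (b - h) b)
    linarith
  have hlow : h * (ψ b - ε / 3) ≤ ∫ t in (b - h)..b, ψ t := by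
    have := intervalIntegral.integral_mono_on (a := b - h) (b := b) (f := fun _ => ψ b - ε / 3)
      (g := ψ) (by linarith) (by simp) (hint _ _) (fun x hx => by
        have h3 := h₁ x (by
          rw [Real.dist_eq, abs_lt]
          constructor <;> linarith [hx.1, hx.2])
        rw [Real.dist_eq, abs_lt] at h3
        linarith [h3.1])
    rwa [intervalIntegral.integral_const, sub_sub_cancel, smul_eq_mul] at this
  have hup : ∫ t in (0 : ℝ)..h, ψ t ≤ h * (ε / 3) := by
    have := intervalIntegral.integral_mono_on (a := 0) (b := h) (g := fun _ => ε / 3)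
      (f := ψ) hh.le (hint _ _) (by simp) (fun x hx => by
        have h3 := h₂ x (by
          rw [Real.dist_eq, abs_lt]
          constructor <;> linarith [hx.1, hx.2])
        rw [Real.dist_eq, abs_lt, hzero] at h3
        linarith [h3.2])
    rwa [intervalIntegral.integral_const, sub_zero, smul_eq_mul] at this
  have h4 := hinc h hh hlδ hlb
  rw [hsplit] at h4
  have h5 : h * ψ b ≤ h * (c * (∫ t in (0 : ℝ)..b, ψ t) + ε) := by linarith
  exact le_of_mul_le_mul_left h5 hh

/-! ### The fundamental theorem of calculus for weak derivatives -/

section WeakDeriv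

theorem deriv_smoothTransition_eq_zero {x : ℝ} (hx : x ∉ Ioc (0 : ℝ) 1) :
    deriv Real.smoothTransition x = 0 := by
  rcases le_or_gt x 0 with h | h
  · refine IsLocalMin.deriv_eq_zero (Eventually.of_forall fun y => ?_)
    rw [Real.smoothTransition.zero_of_nonpos h]
    exact Real.smoothTransition.nonneg y
  · refine IsLocalMax.deriv_eq_zero (Eventually.of_forall fun y => ?_)
    have h1 : 1 ≤ x := by
      by_contra! h1
      exact hx ⟨h, h1.le⟩
    rw [Real.smoothTransition.one_of_one_le h1]
    exact Real.smoothTransition.le_one y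

variable {E : Type*} [NormedAddCommGroup E] [NormedSpace ℝ E]

theorem hasDerivAt_smoothTransition_comp (s ε r : ℝ) :
    HasDerivAt (fun r => Real.smoothTransition (ε⁻¹ * (r - s)))
      (ε⁻¹ * deriv Real.smoothTransition (ε⁻¹ * (r - s))) r := by
  have h1 : HasDerivAt Real.smoothTransition (deriv Real.smoothTransition (ε⁻¹ * (r - s)))
      (ε⁻¹ * (r - s)) :=
    ((Real.smoothTransition.contDiff (n := 1)).differentiable (by simp)).differentiableAt.hasDerivAt
  have h2 : HasDerivAt (fun r : ℝ => ε⁻¹ * (r - s)) (ε⁻¹ * 1) r :=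
    ((hasDerivAt_id r).sub_const s).const_mul _
  have := h1.comp r h2
  rwa [mul_one, mul_comm] at this

/-- Integration against the bump `r ↦ σ'((r - s) / ε) / ε`, where `σ` is the smooth transition from
`0` to `1` on `[0, 1]`, in rescaled form. -/
theorem setIntegral_bump_smul {T s ε : ℝ} (hε : 0 < ε) (hs : 0 < s) (hsT : s + ε < T) (F : ℝ → E) :
    ∫ r in Ioo 0 T, (ε⁻¹ * deriv Real.smoothTransition (ε⁻¹ * (r - s))) • F r
      = ∫ x in (0 : ℝ)..1, deriv Real.smoothTransition x • F (ε * x + s) := by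
  have h1 := intervalIntegral.integral_comp_mul_add (a := 0) (b := 1)
    (fun r => deriv Real.smoothTransition (ε⁻¹ * (r - s)) • F r) hε.ne' s
  simp only [add_sub_cancel_right, inv_mul_cancel_left₀ hε.ne', mul_zero, zero_add, mul_one] at h1
  rw [h1, ← intervalIntegral.integral_smul, intervalIntegral.integral_of_le (by linarith),
    add_comm ε s]
  simp only [smul_smul]
  refine setIntegral_eq_of_subset_of_forall_sdiff_eq_zero measurableSet_Ioo
    (fun r hr => ⟨hs.trans hr.1, hr.2.trans_lt hsT⟩) fun r hr => ?_
  rw [deriv_smoothTransition_eq_zero, mul_zero, zero_smul]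
  intro h
  refine hr.2 ⟨?_, ?_⟩
  · have := (mul_pos_iff_of_pos_left (inv_pos.2 hε)).1 h.1
    linarith
  · have := h.2
    rw [inv_mul_le_iff₀ hε] at this
    linarith

theorem tendsto_integral_bump_smul [CompleteSpace E] {F : ℝ → E} (hF : Continuous F) (s : ℝ) :
    Tendsto (fun ε : ℝ => ∫ x in (0 : ℝ)..1, deriv Real.smoothTransition x • F (ε * x + s))
      (𝓝[>] 0) (𝓝 (F s)) := by
  have hσ : Continuous (deriv Real.smoothTransition) :=
    (Real.smoothTransition.contDiff (n := 1)).continuous_deriv le_rfl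
  have hc : Continuous fun ε : ℝ =>
      ∫ x in (0 : ℝ)..1, deriv Real.smoothTransition x • F (ε * x + s) :=
    intervalIntegral.continuous_parametric_intervalIntegral_of_continuous' (by fun_prop) 0 1
  have h0 := hc.tendsto 0
  simp only [zero_mul, zero_add] at h0
  rw [intervalIntegral.integral_smul_const, intervalIntegral.integral_deriv_eq_sub
    (fun x _ => ((Real.smoothTransition.contDiff (n := 1)).differentiable
      (by simp)).differentiableAt) (hσ.intervalIntegrable _ _), Real.smoothTransition.one,
    Real.smoothTransition.zero, sub_zero, one_smul] at h0
  exact h0.mono_left nhdsWithin_le_nhds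

/-- With `σ` the smooth transition, the smoothed indicator `σ((r - s) / ε) - σ((r - t) / ε)` of
`(s, t]` converges pointwise. -/
theorem tendsto_smoothTransition_sub {s t : ℝ} (hst : s < t) (r : ℝ) :
    Tendsto (fun ε : ℝ => Real.smoothTransition (ε⁻¹ * (r - s))
      - Real.smoothTransition (ε⁻¹ * (r - t))) (𝓝[>] 0)
      (𝓝 ((Ioc s t).indicator (fun _ => (1 : ℝ)) r)) := by
  have hstep : ∀ s : ℝ, Tendsto (fun ε : ℝ => Real.smoothTransition (ε⁻¹ * (r - s))) (𝓝[>] 0)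
      (𝓝 ((Ioi s).indicator (fun _ => (1 : ℝ)) r)) := by
    intro s
    rcases le_or_gt r s with h | h
    · rw [indicator_of_notMem (by simpa using h)]
      refine tendsto_const_nhds.congr' ?_
      filter_upwards [self_mem_nhdsWithin] with ε hε
      rw [Real.smoothTransition.zero_of_nonpos]
      exact mul_nonpos_of_nonneg_of_nonpos (inv_nonneg.2 (le_of_lt hε)) (by linarith)
    · rw [indicator_of_mem (by simpa using h)]
      refine tendsto_const_nhds.congr' ?_
      filter_upwards [Ioo_mem_nhdsGT (sub_pos.2 h)] with ε hε
      rw [Real.smoothTransition.one_of_one_le]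
      rw [le_inv_mul_iff₀ hε.1]
      linarith [hε.2]
  convert (hstep s).sub (hstep t) using 2
  by_cases h1 : s < r <;> by_cases h2 : t < r
  · simp [indicator, h1, h2]
  · simp [indicator, h1, h2, not_lt.1 h2]
  · exact absurd (hst.trans h2) h1
  · simp [indicator, h1, h2]

/-- A continuous representative of a function with integrable weak derivative is an indefinite
integral of that derivative: test with smoothed indicators of `(s, t]`. -/
theorem HasWeakDeriv.integral_eq_sub [CompleteSpace E] {T : ℝ} {g dg F : ℝ → E}
    (h : HasWeakDeriv T g dg) (hdg : IntegrableOn dg (Ioo 0 T)) (hF : Continuous F)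
    (hgF : ∀ᵐ t ∂(volume.restrict (Ioo 0 T)), F t = g t) {s t : ℝ} (hs : 0 < s) (hst : s < t)
    (ht : t < T) : ∫ r in s..t, dg r = F t - F s := by
  set φ : ℝ → ℝ → ℝ := fun ε r => Real.smoothTransition (ε⁻¹ * (r - s))
      - Real.smoothTransition (ε⁻¹ * (r - t)) with hφ
  have hφC : ∀ ε, ContDiff ℝ ∞ (φ ε) := fun ε =>
    (Real.smoothTransition.contDiff.comp (contDiff_const.mul (contDiff_id.sub contDiff_const))).sub
      (Real.smoothTransition.contDiff.comp (contDiff_const.mul (contDiff_id.sub contDiff_const)))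
  have hleft : Tendsto (fun ε => -∫ r in Ioo 0 T, deriv (φ ε) r • g r) (𝓝[>] 0)
      (𝓝 (F t - F s)) := by
    have h1 := (tendsto_integral_bump_smul hF t).sub (tendsto_integral_bump_smul hF s)
    refine h1.congr' ?_
    filter_upwards [Ioo_mem_nhdsGT (sub_pos.2 ht)] with ε hε
    have hsm : ∀ s, Integrable (fun r => (ε⁻¹ * deriv Real.smoothTransition (ε⁻¹ * (r - s))) • F r)
        (volume.restrict (Ioo 0 T)) := fun s => by
      have hσ : Continuous (deriv Real.smoothTransition) :=
        (Real.smoothTransition.contDiff (n := 1)).continuous_deriv le_rfl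
      refine IntegrableOn.mono_set (t := Icc 0 T) ?_ Ioo_subset_Icc_self
      exact (Continuous.continuousOn (by fun_prop)).integrableOn_compact isCompact_Icc
    rw [← setIntegral_bump_smul hε.1 (hs.trans hst) (by linarith [hε.2]) F,
      ← setIntegral_bump_smul hε.1 hs (by linarith [hε.2]) F, ← integral_sub (hsm t) (hsm s),
      ← integral_neg]
    refine integral_congr_ae ?_
    filter_upwards [hgF] with r hr
    have hd : deriv (φ ε) r = ε⁻¹ * deriv Real.smoothTransition (ε⁻¹ * (r - s))
        - ε⁻¹ * deriv Real.smoothTransition (ε⁻¹ * (r - t)) :=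
      ((hasDerivAt_smoothTransition_comp s ε r).sub
        (hasDerivAt_smoothTransition_comp t ε r)).deriv
    rw [hd, hr, ← sub_smul, ← neg_smul, neg_sub]
  have hright : Tendsto (fun ε => ∫ r in Ioo 0 T, φ ε r • dg r) (𝓝[>] 0)
      (𝓝 (∫ r in s..t, dg r)) := by
    have h1 : Tendsto (fun ε => ∫ r in Ioo 0 T, φ ε r • dg r) (𝓝[>] 0)
        (𝓝 (∫ r in Ioo 0 T, (Ioc s t).indicator (fun _ => (1 : ℝ)) r • dg r)) := by
      refine tendsto_integral_filter_of_dominated_convergence (fun r => ‖dg r‖) ?_ ?_ hdg.norm ?_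
      · exact Eventually.of_forall fun ε => (hφC ε).continuous.aestronglyMeasurable.smul hdg.1
      · refine Eventually.of_forall fun ε => Eventually.of_forall fun r => ?_
        rw [norm_smul]
        refine mul_le_of_le_one_left (norm_nonneg _) ?_
        rw [Real.norm_eq_abs, abs_le]
        have a1 := Real.smoothTransition.le_one (ε⁻¹ * (r - s))
        have a2 := Real.smoothTransition.le_one (ε⁻¹ * (r - t))
        have a3 := Real.smoothTransition.nonneg (ε⁻¹ * (r - s))
        have a4 := Real.smoothTransition.nonneg (ε⁻¹ * (r - t))
        constructor <;> simp only [hφ] <;> linarith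
      · exact Eventually.of_forall fun r => (tendsto_smoothTransition_sub hst r).smul_const _
    have hsub : Ioc s t ⊆ Ioo 0 T := fun r hr => ⟨hs.trans hr.1, hr.2.trans_lt ht⟩
    convert h1 using 2
    have e : (fun r => (Ioc s t).indicator (fun _ => (1 : ℝ)) r • dg r) = (Ioc s t).indicator dg := by
      ext r
      by_cases hr : r ∈ Ioc s t <;> simp [hr]
    rw [e, setIntegral_indicator measurableSet_Ioc, intervalIntegral.integral_of_le hst.le,
      inter_eq_self_of_subset_right hsub]
  refine tendsto_nhds_unique hright (hleft.congr' ?_)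
  filter_upwards [Ioo_mem_nhdsGT (sub_pos.2 ht)] with ε hε
  have hzero : ∀ r ∉ Icc s (t + ε), φ ε r = 0 := by
    intro r hr
    have hi := inv_pos.2 hε.1
    rcases lt_or_ge r s with h1 | h1
    · simp only [hφ]
      rw [Real.smoothTransition.zero_of_nonpos (by nlinarith),
        Real.smoothTransition.zero_of_nonpos (by nlinarith), sub_zero]
    · have h2 : t + ε < r := by
        by_contra! h2
        exact hr ⟨h1, h2⟩
      simp only [hφ]
      rw [Real.smoothTransition.one_of_one_le, Real.smoothTransition.one_of_one_le, sub_self] <;>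
      · rw [le_inv_mul_iff₀ hε.1]
        linarith
  refine h (φ ε) (hφC ε) (HasCompactSupport.intro isCompact_Icc hzero) ?_
  refine (closure_minimal (fun r hr => ?_) isClosed_Icc).trans
    (fun r (hr : r ∈ Icc s (t + ε)) => ⟨hs.trans_le hr.1, hr.2.trans_lt (by linarith [hε.2])⟩)
  by_contra hr'
  exact hr (hzero r hr')

end WeakDeriv

/-! ### The distance to the convex set along a solution -/

section Solution

variable {𝕜 V H : Type*} [RCLike 𝕜]
    [NormedAddCommGroup V] [InnerProductSpace 𝕜 V]
    [NormedAddCommGroup H] [InnerProductSpace 𝕜 H]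

theorem lipschitzWith_toAntidual (j : V →L[𝕜] H) : LipschitzWith ‖j‖₊ (toAntidual j) := by
  refine LipschitzWith.of_dist_le_mul fun h k => ?_
  rw [dist_eq_norm, dist_eq_norm]
  refine ContinuousLinearMap.opNorm_le_bound _ (by positivity) fun v => ?_
  rw [sub_apply, toAntidual_apply, toAntidual_apply, ← inner_sub_right]
  refine (norm_inner_le_norm _ _).trans ?_
  calc ‖j v‖ * ‖h - k‖ ≤ ‖j‖ * ‖v‖ * ‖h - k‖ := by gcongr; exact j.le_opNorm v
    _ = _ := by rw [coe_nnnorm]; ring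

/-- One backward step of the evolution from `y` to `v ∈ V`, with time derivative `du` at the end of
the step. With `g = v - p`, where `p` is the projection of `v`, the gradient inequality for the
squared distance bounds the increment by `2 Re ⟨v - y, g⟩`, and the equation gives
`Re ⟨du, g⟩ = Re ⟨F, g⟩ - Re a(p, g) - Re a(g, g) ≤ b ‖g‖_H²`. The last summand measures how far
`v - y` is from `h • du` in `V'`. -/
theorem norm_sub_proj_sq_increment_le {j : V →L[𝕜] H} {a : V →ₗ[𝕜] V →ₗ⋆[𝕜] 𝕜}
    {F du : Antidual 𝕜 V} {b h : ℝ} (hh : 0 ≤ h) {C : Set H} {v p : V} {y q : H}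
    (hp : ∀ z ∈ C, RCLike.re (inner 𝕜 (j v - j p) (z - j p)) ≤ 0) (hq : q ∈ C)
    (heq : ∀ z, du z + a v z = F z)
    (hineq : RCLike.re (F (v - p)) ≤ RCLike.re (a p (v - p)))
    (hco : ∀ u, 0 ≤ RCLike.re (a u u) + b * ‖j u‖ ^ 2) :
    ‖j v - j p‖ ^ 2 - ‖y - q‖ ^ 2 ≤ 2 * h * b * ‖j v - j p‖ ^ 2
      + 2 * ‖v - p‖ * ‖toAntidual j (j v - y) - h • du‖ := by
  refine (norm_sub_proj_sq_sub_le (y := y) hp hq).trans ?_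
  have h1 : (inner 𝕜 (j v - j p) (j v - y) : 𝕜)
      = h • du (v - p) + (toAntidual j (j v - y) - h • du) (v - p) := by
    rw [sub_apply, toAntidual_apply, map_sub j v p,
      smul_apply]
    ring
  have h2 : RCLike.re (du (v - p)) ≤ b * ‖j v - j p‖ ^ 2 := by
    have h3 := congrArg RCLike.re (heq (v - p))
    have h4 := hco (v - p)
    rw [map_add] at h3
    rw [← map_sub j v p]
    have h5 : a v (v - p) = a p (v - p) + a (v - p) (v - p) := by
      rw [← LinearMap.add_apply, ← map_add]
      congr 2
      abel
    rw [h5, map_add] at h3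
    linarith
  have h6 : RCLike.re ((toAntidual j (j v - y) - h • du) (v - p))
      ≤ ‖toAntidual j (j v - y) - h • du‖ * ‖v - p‖ :=
    (RCLike.re_le_norm _).trans (ContinuousLinearMap.le_opNorm _ _)
  rw [h1, map_add, RCLike.smul_re]
  nlinarith [mul_le_mul_of_nonneg_left h2 hh]

/-- The inequality assumed for each `v` almost everywhere in time holds, off a single null set, for
all `v` at once. -/
theorem ae_forall_re_form_ge [CompleteSpace V] [CompleteSpace H]
    [TopologicalSpace.SeparableSpace V] {j : V →L[𝕜] H} (hj : Function.Injective j) {T : ℝ}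
    {a : ℝ → V →ₗ[𝕜] V →ₗ⋆[𝕜] 𝕜} {f : ℝ → Antidual 𝕜 V} {M b α : ℝ}
    (hM : ∀ t ∈ Icc 0 T, ∀ u v : V, ‖a t u v‖ ≤ M * ‖u‖ * ‖v‖) (hα : 0 < α)
    (hco : ∀ t ∈ Icc 0 T, ∀ u : V, α * ‖u‖ ^ 2 ≤ RCLike.re (a t u u) + b * ‖j u‖ ^ 2)
    {c : ℝ} (hc : 0 ≤ c) {S : Set V} {p : V → V} (hpc : ∀ v ∈ S, ‖j (p v)‖ ≤ ‖j v‖ + c)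
    (hp : ∀ v ∈ S, ∀ w ∈ S, ‖j (p v) - j (p w)‖ ≤ ‖j v - j w‖)
    (h : ∀ v ∈ S, ∀ᵐ t ∂(volume.restrict (Icc 0 T)),
      RCLike.re (f t (v - p v)) ≤ RCLike.re (a t (p v) (v - p v))) :
    ∀ᵐ t ∂(volume.restrict (Icc 0 T)), ∀ v ∈ S,
      RCLike.re (f t (v - p v)) ≤ RCLike.re (a t (p v) (v - p v)) := by
  obtain ⟨D, hDS, hDc, hDd⟩ :=
    (TopologicalSpace.IsSeparable.of_separableSpace S).exists_countable_dense_subset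
  have hD := (ae_ball_iff hDc).2 fun v hv => h v (hDS hv)
  filter_upwards [hD, ae_restrict_mem measurableSet_Icc] with t ht htT v hv
  exact re_form_ge_of_mem_closure hj (f t) (hM t htT) hα (hco t htT) hc hDS p hpc hp ht hv (hDd hv)

/-- The distance in `V'` from the increment of a solution over `[t - h, t]` to `h • du t` is at most
the oscillation of `du` around `du t`. -/
theorem enorm_toAntidual_sub_smul_le {j : V →L[𝕜] H} {T : ℝ} {u : ℝ → V} {du : ℝ → Antidual 𝕜 V}
    {W : ℝ → H} (hMR : MemMR j T u du) (hW : Continuous W)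
    (hWu : ∀ᵐ t ∂(volume.restrict (Ioo 0 T)), W t = j (u t)) {h t : ℝ} (hh : 0 < h)
    (ht : t ∈ Ioo h T) :
    ‖toAntidual j (W t - W (t - h)) - h • du t‖ₑ
      ≤ ∫⁻ s in Ioc (t - h) t, ‖(Ioo 0 T).indicator du s - (Ioo 0 T).indicator du t‖ₑ := by
  have hdu : IntegrableOn du (Ioo 0 T) := MemLp.integrable (by norm_num) hMR.memL2_deriv
  have hIoc : Ioc (t - h) t ⊆ Ioo 0 T := fun s hs =>
    ⟨(sub_pos.2 ht.1).trans hs.1, hs.2.trans_lt ht.2⟩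
  have htT : t ∈ Ioo 0 T := ⟨hh.trans ht.1, ht.2⟩
  have hftc : toAntidual j (W t - W (t - h)) = ∫ s in (t - h)..t, du s := by
    rw [hMR.weakDeriv.integral_eq_sub (F := fun t => toAntidual j (W t)) hdu
      ((lipschitzWith_toAntidual j).continuous.comp hW)
      (by filter_upwards [hWu] with t ht; rw [ht]) (sub_pos.2 ht.1) (by linarith) ht.2]
    ext v
    simp only [sub_apply, toAntidual_apply, inner_sub_right]
  have e : (∫ s in (t - h)..t, du s) - h • du t
      = ∫ s in Ioc (t - h) t, ((Ioo 0 T).indicator du s - (Ioo 0 T).indicator du t) := by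
    have hi : IntervalIntegrable du volume (t - h) t :=
      (intervalIntegrable_iff_integrableOn_Ioc_of_le (by linarith)).2 (hdu.mono_set hIoc)
    have e1 : h • du t = ∫ s in (t - h)..t, du t := by
      rw [intervalIntegral.integral_const, sub_sub_cancel]
    rw [e1, ← intervalIntegral.integral_sub hi intervalIntegrable_const,
      intervalIntegral.integral_of_le (by linarith)]
    refine setIntegral_congr_fun measurableSet_Ioc fun s hs => ?_
    rw [indicator_of_mem (hIoc hs), indicator_of_mem htT]
  rw [hftc, e]
  exact enorm_integral_le_lintegral_enorm _

theorem integral_le_of_lintegral_ofReal_le {X : Type*} [MeasurableSpace X] {μ : Measure X}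
    {φ : X → ℝ} (hφ : Integrable φ μ) {c : ℝ} (hc : 0 ≤ c)
    (h : ∫⁻ x, ENNReal.ofReal (φ x) ∂μ ≤ ENNReal.ofReal c) : ∫ x, φ x ∂μ ≤ c := by
  rw [integral_eq_lintegral_pos_part_sub_lintegral_neg_part hφ]
  have := ENNReal.toReal_mono ENNReal.ofReal_ne_top h
  rw [ENNReal.toReal_ofReal hc] at this
  linarith [ENNReal.toReal_nonneg (a := ∫⁻ x, ENNReal.ofReal (-φ x) ∂μ)]

theorem integral_increment_le_of_ae {ψ : ℝ → ℝ} (hψ : Continuous ψ) (hψ0 : ∀ t, 0 ≤ ψ t)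
    {B : ℝ → ENNReal} {h r c ε : ℝ} (hh : 0 < h) (hhr : h < r) (hc : 0 ≤ c) (hε : 0 ≤ ε)
    (hpt : ∀ᵐ t ∂(volume.restrict (Ioc h r)), ENNReal.ofReal (ψ t - ψ (t - h) - h * c * ψ t) ≤ B t)
    (hB : ∫⁻ t, B t ≤ ENNReal.ofReal (ε * h)) :
    ∫ t in h..r, (ψ t - ψ (t - h)) ≤ h * (c * (∫ t in (0 : ℝ)..r, ψ t) + ε) := by
  have hint : ∀ {φ : ℝ → ℝ}, Continuous φ → ∀ x y, IntervalIntegrable φ volume x y :=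
    fun hφ x y => hφ.intervalIntegrable x y
  have hfin := integral_le_of_lintegral_ofReal_le
    ((hint (show Continuous fun t => ψ t - ψ (t - h) - h * c * ψ t by fun_prop) h r).1)
    (by positivity) ((lintegral_mono_ae hpt).trans ((setLIntegral_le_lintegral _ _).trans hB))
  rw [← intervalIntegral.integral_of_le hhr.le, intervalIntegral.integral_sub
    (hint (by fun_prop) _ _) (hint (by fun_prop) _ _),
    intervalIntegral.integral_const_mul] at hfin
  have hmono : ∫ t in h..r, ψ t ≤ ∫ t in (0 : ℝ)..r, ψ t := by
    rw [← intervalIntegral.integral_add_adjacent_intervals (hint hψ 0 h) (hint hψ h r)]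
    linarith [intervalIntegral.integral_nonneg (μ := volume) hh.le
      fun t (_ : t ∈ Icc 0 h) => hψ0 t]
  have h5 := mul_le_mul_of_nonneg_left hmono (show 0 ≤ h * c by positivity)
  linarith

/-- The increments of the squared distance `ψ` to `C` along a solution satisfy
`ψ(t) - ψ(t - h) ≤ 2 h |b| ψ(t)` up to the oscillation of `du` on `(t - h, t]`. -/
theorem ae_increment_le {j : V →L[𝕜] H} {T : ℝ}
    {a : ℝ → V →ₗ[𝕜] V →ₗ⋆[𝕜] 𝕜} {f : ℝ → Antidual 𝕜 V} {b K : ℝ}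
    (hco : ∀ t ∈ Icc 0 T, ∀ u : V, 0 ≤ RCLike.re (a t u u) + b * ‖j u‖ ^ 2)
    {C : Set H} {P : H → H} (hPC : ∀ x, P x ∈ C)
    (hP : ∀ x, ∀ z ∈ C, RCLike.re (inner 𝕜 (x - P x) (z - P x)) ≤ 0)
    {u : ℝ → V} {du : ℝ → Antidual 𝕜 V} {W : ℝ → H} (hMR : MemMR j T u du)
    (heq : ∀ᵐ t ∂(volume.restrict (Ioo 0 T)), ∀ v : V, du t v + a t (u t) v = f t v)
    (hW : Continuous W) (hWu : ∀ᵐ t ∂(volume.restrict (Ioo 0 T)), W t = j (u t))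
    (hp : ∀ᵐ t ∂(volume.restrict (Ioo 0 T)), ∃ p : V, j p = P (j (u t)) ∧
      ‖p‖ ≤ K * (1 + ‖u t‖) ∧ RCLike.re (f t (u t - p)) ≤ RCLike.re (a t p (u t - p)))
    {r h : ℝ} (hr : r ≤ T) (hh : 0 < h) :
    ∀ᵐ t ∂(volume.restrict (Ioc h r)),
      ENNReal.ofReal (‖W t - P (W t)‖ ^ 2 - ‖W (t - h) - P (W (t - h))‖ ^ 2
          - h * (2 * |b|) * ‖W t - P (W t)‖ ^ 2)
        ≤ ‖(Ioo 0 T).indicator (fun t => 2 * ((K + 1) * (1 + ‖u t‖))) t‖ₑ *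
          ∫⁻ s in Ioc (t - h) t, ‖(Ioo 0 T).indicator du s - (Ioo 0 T).indicator du t‖ₑ := by
  have hsub : Ioo h r ⊆ Ioo 0 T := fun t ht => ⟨hh.trans ht.1, ht.2.trans_le hr⟩
  rw [← Measure.restrict_congr_set Ioo_ae_eq_Ioc]
  filter_upwards [ae_restrict_of_ae_restrict_of_subset hsub heq,
    ae_restrict_of_ae_restrict_of_subset hsub hWu, ae_restrict_of_ae_restrict_of_subset hsub hp,
    ae_restrict_mem measurableSet_Ioo] with t h1 h2 ⟨p, hpP, hpK, hineq⟩ ht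
  have htT := hsub ht
  have hstep := norm_sub_proj_sq_increment_le (j := j) (a := a t) (F := f t) (du := du t) (b := b)
    (h := h) hh.le (C := C) (v := u t) (p := p) (y := W (t - h)) (q := P (W (t - h)))
    (by rw [hpP]; exact hP _) (hPC _) h1 hineq (hco t (Ioo_subset_Icc_self htT))
  rw [hpP, ← h2] at hstep
  refine le_trans ?_ (mul_le_mul_right (enorm_toAntidual_sub_smul_le hMR hW hWu hh ⟨ht.1, htT.2⟩) _)
  rw [indicator_of_mem htT, ← ofReal_norm, ← ofReal_norm, ← ENNReal.ofReal_mul (norm_nonneg _)]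
  refine ENNReal.ofReal_le_ofReal ?_
  have hmt : 2 * ‖u t - p‖ ≤ ‖2 * ((K + 1) * (1 + ‖u t‖))‖ := by
    refine le_trans ?_ (le_abs_self _)
    have := norm_sub_le (u t) p
    linarith
  have h3 := mul_le_mul_of_nonneg_right hmt
    (norm_nonneg (toAntidual j (W t - W (t - h)) - h • du t))
  have h4 : 2 * h * b * ‖W t - P (W t)‖ ^ 2 ≤ 2 * h * |b| * ‖W t - P (W t)‖ ^ 2 := by
    gcongr
    exact le_abs_self b
  linarith

/-- Along a solution, the squared distance `ψ` to `C` satisfies the averaged differential inequality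
`ψ' ≤ 2 |b| ψ`. The curve `t ↦ u t - p t` enters only through its size, so no measurability of the
projected curve `p` in `V` is needed. -/
theorem exists_integral_increment_le {j : V →L[𝕜] H} {T : ℝ}
    {a : ℝ → V →ₗ[𝕜] V →ₗ⋆[𝕜] 𝕜} {f : ℝ → Antidual 𝕜 V} {b K : ℝ}
    (hco : ∀ t ∈ Icc 0 T, ∀ u : V, 0 ≤ RCLike.re (a t u u) + b * ‖j u‖ ^ 2)
    {C : Set H} {P : H → H} (hPC : ∀ x, P x ∈ C) (hPcont : Continuous P)
    (hP : ∀ x, ∀ z ∈ C, RCLike.re (inner 𝕜 (x - P x) (z - P x)) ≤ 0)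
    {u : ℝ → V} {du : ℝ → Antidual 𝕜 V} {W : ℝ → H} (hMR : MemMR j T u du)
    (heq : ∀ᵐ t ∂(volume.restrict (Ioo 0 T)), ∀ v : V, du t v + a t (u t) v = f t v)
    (hW : Continuous W) (hWu : ∀ᵐ t ∂(volume.restrict (Ioo 0 T)), W t = j (u t))
    (hp : ∀ᵐ t ∂(volume.restrict (Ioo 0 T)), ∃ p : V, j p = P (j (u t)) ∧
      ‖p‖ ≤ K * (1 + ‖u t‖) ∧ RCLike.re (f t (u t - p)) ≤ RCLike.re (a t p (u t - p)))
    {r : ℝ} (hr : r ∈ Ioc 0 T) {ε : ℝ} (hε : 0 < ε) :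
    ∃ δ > 0, ∀ h, 0 < h → h < δ → h < r →
      ∫ t in h..r, (‖W t - P (W t)‖ ^ 2 - ‖W (t - h) - P (W (t - h))‖ ^ 2)
        ≤ h * (2 * |b| * (∫ t in (0 : ℝ)..r, ‖W t - P (W t)‖ ^ 2) + ε) := by
  have hDL : MemLp ((Ioo 0 T).indicator du) 2 volume :=
    (memLp_indicator_iff_restrict measurableSet_Ioo).2 hMR.memL2_deriv
  have hu : MemLp (fun t => ‖u t‖) 2 (volume.restrict (Ioo 0 T)) := MemLp.norm hMR.memL2
  have hu' : MemLp (fun t => 2 * ((K + 1) * (1 + ‖u t‖))) 2 (volume.restrict (Ioo 0 T)) :=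
    (((memLp_const (1 : ℝ)).add hu).const_mul (K + 1)).const_mul 2
  have hmL : MemLp ((Ioo 0 T).indicator fun t => 2 * ((K + 1) * (1 + ‖u t‖))) 2 volume :=
    (memLp_indicator_iff_restrict measurableSet_Ioo).2 hu'
  obtain ⟨δ, hδ, hδ'⟩ := exists_forall_lintegral_enorm_mul_le hmL hDL hε
  refine ⟨δ, hδ, fun h hh hhδ hhr => ?_⟩
  have hae := ae_increment_le hco hPC hP hMR heq hW hWu hp hr.2 hh
  have hψ : Continuous fun t => ‖W t - P (W t)‖ ^ 2 := by fun_prop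
  exact integral_increment_le_of_ae hψ (fun t => sq_nonneg _) hh hhr (by positivity) hε.le hae
    (hδ' h hh hhδ)

end Solution

end NonautForm

/-! ### Invariance of the intersection -/

theorem mainTheorem2 {𝕜 V H : Type*} [RCLike 𝕜]
    [NormedAddCommGroup V] [InnerProductSpace 𝕜 V] [CompleteSpace V]
    [TopologicalSpace.SeparableSpace V]
    [NormedAddCommGroup H] [InnerProductSpace 𝕜 H] [CompleteSpace H]
    [TopologicalSpace.SeparableSpace H]
    [NormedSpace ℝ H] [IsScalarTower ℝ 𝕜 H]
    (j : V →L[𝕜] H) (hj_inj : Function.Injective j) (hj_dense : DenseRange j)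
    (T : ℝ) (hT : 0 < T)
    (a : ℝ → V →ₗ[𝕜] V →ₗ⋆[𝕜] 𝕜) (ha : NonautForm.IsNonautonomousClosedForm j T a)
    (f : ℝ → NonautForm.Antidual 𝕜 V) (hf : NonautForm.MemL2 T f)
    (C₁ C₂ : Set H) (hC₁_closed : IsClosed C₁) (hC₁_convex : Convex ℝ C₁)
    (hC₂_nonempty : C₂.Nonempty) (hC₂_closed : IsClosed C₂) (hC₂_convex : Convex ℝ C₂)
    (hC₁_inv : NonautForm.IsInvariant j T a f C₁)
    (hC₂ : ∀ v : V, j v ∈ C₁ →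
      ∃ p : V, j p = NonautForm.proj 𝕜 hC₂_nonempty hC₂_closed hC₂_convex (j v) ∧
        ∀ᵐ t ∂(MeasureTheory.volume.restrict (Set.Icc 0 T)),
          RCLike.re (a t p (v - p)) ≥ RCLike.re (f t (v - p))) :
    NonautForm.IsInvariant j T a f (C₁ ∩ C₂) := by
  rintro u₀ ⟨hu₁, hu₂⟩ u w hsol t ht
  have hwC₁ := hC₁_inv u₀ hu₁ u w hsol
  refine ⟨hwC₁ t ht, ?_⟩
  obtain ⟨M, hM⟩ := ha.bounded
  obtain ⟨b, α, hα, hco⟩ := ha.quasiCoercive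
  obtain ⟨du, hMR, heq⟩ := hsol.equation
  set P : H → H := NonautForm.proj 𝕜 hC₂_nonempty hC₂_closed hC₂_convex with hPdef
  have hPC : ∀ x, P x ∈ C₂ := fun x => (NonautForm.proj_spec 𝕜 _ _ _ x).1
  have hP : ∀ x, ∀ z ∈ C₂, RCLike.re (inner 𝕜 (x - P x) (z - P x)) ≤ 0 :=
    fun x => (NonautForm.proj_spec 𝕜 _ _ _ x).2
  have hPlip : ∀ x y, ‖P x - P y‖ ≤ ‖x - y‖ := fun x y =>
    NonautForm.norm_proj_sub_proj_le (hPC x) (hPC y) (hP x) (hP y)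
  have hPcont : Continuous P := (LipschitzWith.of_dist_le_mul (K := 1) fun x y => by
    simpa [dist_eq_norm] using hPlip x y).continuous
  have hPnorm : ∀ x, ‖P x‖ ≤ ‖x‖ + ‖P 0‖ := fun x => by
    have h1 := hPlip x 0
    rw [sub_zero] at h1
    linarith [norm_le_norm_sub_add (P x) (P 0)]
  choose! p hp hineq using hC₂
  have hall := NonautForm.ae_forall_re_form_ge hj_inj (S := {v | j v ∈ C₁}) (p := p) hM hα hco
    (norm_nonneg (P 0)) (fun v hv => by rw [hp v hv]; exact hPnorm _)
    (fun v hv w hw => by rw [hp v hv, hp w hw]; exact hPlip _ _) hineq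
  -- the bound on `p` at a single good time is uniform, since `p` does not depend on time
  obtain ⟨K, hK, hpK⟩ : ∃ K : ℝ, 0 ≤ K ∧ ∀ v, j v ∈ C₁ → ‖p v‖ ≤ K * (1 + ‖v‖) := by
    have : (ae (volume.restrict (Icc 0 T))).NeBot := by
      rw [ae_neBot, Ne, Measure.restrict_eq_zero, Real.volume_Icc]
      simpa using hT
    obtain ⟨s, hs, hsT⟩ := (hall.and (ae_restrict_mem measurableSet_Icc)).exists
    obtain ⟨K, hK, hbound⟩ := NonautForm.exists_norm_le_of_re_form_ge j (f s) (hM s hsT) hα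
      (hco s hsT) ‖P 0‖ (norm_nonneg _)
    exact ⟨K, hK, fun v hv => hbound v (p v) (by rw [hp v hv]; exact hPnorm _) (hs v hv)⟩
  have hwrep := hsol.representative
  -- a continuous extension of `w` to the whole line
  set W : ℝ → H := IccExtend hT.le ((Icc 0 T).domRestrict w) with hWdef
  have hW : Continuous W := hsol.continuousOn.domRestrict.Icc_extend'
  have hWw : ∀ s ∈ Icc 0 T, W s = w s := fun s hs => by
    rw [hWdef, IccExtend_of_mem hT.le _ hs, domRestrict_apply]
  have hWu : ∀ᵐ s ∂(volume.restrict (Ioo 0 T)), W s = j (u s) := by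
    filter_upwards [hwrep, ae_restrict_mem measurableSet_Ioo] with s hs hsT
    rw [hWw s (Ioo_subset_Icc_self hsT), hs]
  have hgood : ∀ᵐ s ∂(volume.restrict (Ioo 0 T)), ∃ q : V, j q = P (j (u s)) ∧
      ‖q‖ ≤ K * (1 + ‖u s‖) ∧ RCLike.re (f s (u s - q)) ≤ RCLike.re (a s q (u s - q)) := by
    filter_upwards [hwrep, ae_restrict_of_ae_restrict_of_subset Ioo_subset_Icc_self hall,
      ae_restrict_mem measurableSet_Ioo] with s hs hs' hsT
    have hmem : j (u s) ∈ C₁ := hs ▸ hwC₁ s (Ioo_subset_Icc_self hsT)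
    exact ⟨p (u s), hp _ hmem, hpK _ hmem, hs' _ hmem⟩
  have hzero : ‖W 0 - P (W 0)‖ ^ 2 = 0 := by
    rw [hWw 0 ⟨le_rfl, hT.le⟩, hsol.initial]
    have := hP u₀ u₀ hu₂
    rw [inner_self_eq_norm_sq] at this
    exact le_antisymm this (sq_nonneg _)
  have hψ := NonautForm.nonpos_of_integral_increment_le
    (ψ := fun s => ‖W s - P (W s)‖ ^ 2) (T := T) (c := 2 * |b|) (by fun_prop)
    (fun s => sq_nonneg _) hzero (fun r hr ε hε =>
      NonautForm.exists_integral_increment_le (K := K)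
        (fun s hs v => (by positivity : 0 ≤ α * ‖v‖ ^ 2).trans (hco s hs v)) hPC hPcont hP
        hMR heq hW hWu hgood hr hε) ht
  have hfix : w t - P (w t) = 0 := by
    rw [← hWw t ht, ← norm_eq_zero]
    exact pow_eq_zero_iff two_ne_zero |>.1 (le_antisymm hψ (sq_nonneg _))
  rw [sub_eq_zero.1 hfix]
  exact hPC _
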